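/- For a complex $n\times n$ matrix $x$ with no eigenvalue in $]-\infty,0]$, let $\log(x)$ denote its principal logarithm, i.e. the unique complex $n\times n$ matrix $a$ such that $e^{a}=x$ and every eigenvalue $z$ of $a$ satisfies $-\pi<\operatorname{Im}(z)<\pi$. Let $x,y$ be $2\times 2$ complex matrices such that none of $x$, $y$, $xy$ has an eigenvalue in $]-\infty,0]$, and suppose that $\log(xy)=\log(x)+\log(y)$. Then $x$ and $y$ commute, i.e. $xy=yx$. -/

import Mathlib

/-- The matrix `x` has no eigenvalue in the half-line `]-∞, 0]`. -/
def NoNonposEigenvalue {n : ℕ} (x : Matrix (Fin n) (Fin n) ℂ) : Prop :=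
  ∀ t : ℝ, t ≤ 0 → (t : ℂ) ∉ spectrum ℂ x

/-- `a` is a principal logarithm of `x`: `e ^ a = x` and every eigenvalue of `a` lies in the open
strip `-π < Im z < π`. -/
def IsPrincipalLog {n : ℕ} (x a : Matrix (Fin n) (Fin n) ℂ) : Prop :=
  NormedSpace.exp a = x ∧ ∀ z ∈ spectrum ℂ a, z.im ∈ Set.Ioo (-Real.pi) Real.pi

open Classical in
/-- The principal logarithm of `x` (and `0` when `x` has none). -/
noncomputable def matrixLog {n : ℕ} (x : Matrix (Fin n) (Fin n) ℂ) : Matrix (Fin n) (Fin n) ℂ :=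
  if h : ∃ a, IsPrincipalLog x a then h.choose else 0

namespace MatrixLog

lemma spec_pair (a : Matrix (Fin 2) (Fin 2) ℂ) :
    ∃ p ∈ spectrum ℂ a, ∃ q ∈ spectrum ℂ a, (a - p • 1) * (a - q • 1) = 0 := by
  obtain ⟨p, hp⟩ := spectrum.nonempty_of_isAlgClosed_of_finiteDimensional ℂ a
  have key : ∀ z : ℂ, z ∈ spectrum ℂ a ↔ (z - a 0 0) * (z - a 1 1) - a 0 1 * a 1 0 = 0 := by
    intro z
    rw [spectrum.mem_iff, Matrix.isUnit_iff_isUnit_det, isUnit_iff_ne_zero, not_not,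
      Matrix.det_fin_two]
    simp [Matrix.algebraMap_matrix_apply]
  rw [key] at hp
  refine ⟨p, (key p).2 hp, a 0 0 + a 1 1 - p, (key _).2 ?_, ?_⟩
  · linear_combination hp
  · ext i j
    fin_cases i <;> fin_cases j <;> simp [Matrix.mul_apply, Fin.sum_univ_two]
    · linear_combination -hp
    · ring
    · ring
    · linear_combination -hp

lemma spec_sub {a : Matrix (Fin 2) (Fin 2) ℂ} {p q : ℂ}
    (h : (a - p • 1) * (a - q • 1) = 0) {z : ℂ} (hz : z ∈ spectrum ℂ a) : z = p ∨ z = q := by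
  by_contra hne
  push Not at hne
  have h0 : (z - p) * (z - q) ≠ 0 := mul_ne_zero (sub_ne_zero.2 hne.1) (sub_ne_zero.2 hne.2)
  have e : (z • (1 : Matrix (Fin 2) (Fin 2) ℂ) - a) * (a - (p + q - z) • 1)
      = ((z - p) * (z - q)) • 1 - (a - p • 1) * (a - q • 1) := by
    ext i j
    fin_cases i <;> fin_cases j <;> simp [Matrix.mul_apply, Fin.sum_univ_two] <;> ring
  rw [h, sub_zero] at e
  apply (spectrum.mem_iff.1 hz)
  rw [Algebra.algebraMap_eq_smul_one, Matrix.isUnit_iff_isUnit_det, isUnit_iff_ne_zero]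
  intro hd
  have := congrArg Matrix.det e
  rw [Matrix.det_mul, hd, zero_mul, Matrix.det_smul, Matrix.det_one] at this
  simp only [Fintype.card_fin, mul_one] at this
  exact pow_ne_zero 2 h0 this.symm

lemma hasSum_mexp (a : Matrix (Fin 2) (Fin 2) ℂ) :
    HasSum (fun n : ℕ => ((n.factorial : ℂ)⁻¹) • a ^ n) (NormedSpace.exp a) := by
  open scoped Matrix.Norms.Operator in
  exact NormedSpace.exp_series_hasSum_exp' (𝕂 := ℂ) a

lemma hasSum_cexp (p : ℂ) :
    HasSum (fun n : ℕ => ((n.factorial : ℂ)⁻¹) * p ^ n) (Complex.exp p) := by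
  have := NormedSpace.exp_series_hasSum_exp' (𝕂 := ℂ) p
  rw [← Complex.exp_eq_exp_ℂ] at this
  simpa using this

lemma exp_of_mul_eq_zero {a : Matrix (Fin 2) (Fin 2) ℂ} {p q : ℂ}
    (h : (a - p • 1) * (a - q • 1) = 0) :
    (p - q) • NormedSpace.exp a = Complex.exp p • (a - q • 1) - Complex.exp q • (a - p • 1) := by
  have ha : a * (a - q • 1) = p • (a - q • 1) := by
    rw [sub_mul, smul_mul_assoc, one_mul, sub_eq_zero] at h
    exact h
  have hb : a * (a - p • 1) = q • (a - p • 1) := by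
    have : (a - q • 1) * (a - p • 1) = 0 := by
      rw [← h]; simp only [sub_mul, mul_sub, smul_mul_assoc, mul_smul_comm, one_mul, mul_one,
        smul_sub, smul_smul, mul_comm p q]
      abel
    rw [sub_mul, smul_mul_assoc, one_mul, sub_eq_zero] at this
    exact this
  have hpow : ∀ n : ℕ, (p - q) • a ^ n = p ^ n • (a - q • 1) - q ^ n • (a - p • 1) := by
    intro n
    induction n with
    | zero => simp [sub_smul]
    | succ n ih =>
      rw [pow_succ', ← mul_smul_comm, ih, mul_sub, mul_smul_comm, mul_smul_comm, ha, hb,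
        smul_smul, smul_smul, pow_succ, pow_succ]
  have h1 := (hasSum_mexp a).const_smul (p - q)
  have h2 := ((hasSum_cexp p).smul_const (a - q • 1)).sub
    ((hasSum_cexp q).smul_const (a - p • 1))
  have hf : (fun n : ℕ => (p - q) • ((n.factorial : ℂ)⁻¹) • a ^ n) = fun n : ℕ =>
      ((n.factorial : ℂ)⁻¹ * p ^ n) • (a - q • 1) - ((n.factorial : ℂ)⁻¹ * q ^ n) • (a - p • 1) := by
    funext n
    rw [smul_comm, hpow, smul_sub, smul_smul, smul_smul]
  rw [hf] at h1
  exact h1.unique h2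

lemma exp_of_sq_eq_zero {a : Matrix (Fin 2) (Fin 2) ℂ} {p : ℂ}
    (h : (a - p • 1) * (a - p • 1) = 0) :
    NormedSpace.exp a = Complex.exp p • (1 + (a - p • 1)) := by
  set N := a - p • (1 : Matrix (Fin 2) (Fin 2) ℂ) with hN
  have ha : a = p • 1 + N := by simp [hN]
  have h1 : NormedSpace.exp (p • (1 : Matrix (Fin 2) (Fin 2) ℂ)) = Complex.exp p • 1 := by
    refine (hasSum_mexp _).unique ?_
    convert (hasSum_cexp p).smul_const (1 : Matrix (Fin 2) (Fin 2) ℂ) using 2 with n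
    rw [smul_pow, one_pow, smul_smul]
  have h2 : NormedSpace.exp N = 1 + N := by
    refine (hasSum_mexp N).unique ?_
    have := hasSum_sum_of_ne_finset_zero (f := fun n : ℕ => ((n.factorial : ℂ)⁻¹) • N ^ n)
      (s := Finset.range 2) (L := SummationFilter.unconditional ℕ) (by
        intro n hn
        have hn2 : 2 ≤ n := by
          rw [Finset.mem_range] at hn
          omega
        obtain ⟨k, rfl⟩ := Nat.exists_eq_add_of_le hn2
        rw [pow_add, pow_two, h, zero_mul, smul_zero])
    simpa [Finset.sum_range_succ] using this
  rw [ha, Matrix.exp_add_of_commute _ _ ((Commute.one_left N).smul_left p), h1, h2,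
    smul_mul_assoc, one_mul]

lemma mem_slit {x : Matrix (Fin 2) (Fin 2) ℂ} (hx : NoNonposEigenvalue x) {p : ℂ}
    (hp : p ∈ spectrum ℂ x) : p ∈ Complex.slitPlane := by
  by_contra hn
  rw [Complex.mem_slitPlane_iff] at hn
  push Not at hn
  refine hx p.re hn.1 ?_
  have : ((p.re : ℝ) : ℂ) = p := Complex.ext (by simp) (by simp [hn.2])
  rwa [this]

lemma log_strip {p : ℂ} (hp : p ∈ Complex.slitPlane) :
    (Complex.log p).im ∈ Set.Ioo (-Real.pi) Real.pi := by
  rw [Complex.log_im]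
  exact ⟨Complex.neg_pi_lt_arg p,
    lt_of_le_of_ne (Complex.arg_le_pi p) (Complex.slitPlane_arg_ne_pi hp)⟩

/-- A 2×2 matrix without eigenvalues in `]-∞, 0]` has a principal logarithm. -/
theorem exists_isPrincipalLog {x : Matrix (Fin 2) (Fin 2) ℂ} (hx : NoNonposEigenvalue x) :
    ∃ a, IsPrincipalLog x a := by
  obtain ⟨p, hp, q, hq, h⟩ := spec_pair x
  have hp' := mem_slit hx hp
  have hq' := mem_slit hx hq
  have ep := Complex.exp_log (Complex.slitPlane_ne_zero hp')
  have eq := Complex.exp_log (Complex.slitPlane_ne_zero hq')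
  by_cases hpq : p = q
  · subst hpq
    have p0 := Complex.slitPlane_ne_zero hp'
    have e : (Complex.log p • 1 + p⁻¹ • (x - p • 1)) - Complex.log p • 1
        = p⁻¹ • (x - p • 1) := by abel
    have h' : ((Complex.log p • 1 + p⁻¹ • (x - p • 1)) - Complex.log p • 1) *
        ((Complex.log p • 1 + p⁻¹ • (x - p • 1)) - Complex.log p • 1) = 0 := by
      rw [e, smul_mul_smul_comm, h, smul_zero]
    refine ⟨Complex.log p • 1 + p⁻¹ • (x - p • 1), ?_, ?_⟩
    · rw [exp_of_sq_eq_zero h', e, ep, smul_add, smul_smul, mul_inv_cancel₀ p0, one_smul]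
      abel
    · intro z hz
      rcases spec_sub h' hz with rfl | rfl <;> exact log_strip hp'
  · have d0 : p - q ≠ 0 := sub_ne_zero.2 hpq
    have hL : Complex.log p ≠ Complex.log q := fun hl => hpq (by rw [← ep, ← eq, hl])
    have D0 : Complex.log p - Complex.log q ≠ 0 := sub_ne_zero.2 hL
    set L := Complex.log p
    set M := Complex.log q
    set c := (L - M) / (p - q) with hc
    have e1 : (M • 1 + c • (x - q • 1)) - M • 1 = c • (x - q • 1) := by abel
    have e2 : (M • 1 + c • (x - q • 1)) - L • 1 = c • (x - p • 1) := by
      have : L = M + c * (p - q) := by rw [hc]; field_simp; ring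
      rw [this]
      module
    have h' : ((M • 1 + c • (x - q • 1)) - L • 1) * ((M • 1 + c • (x - q • 1)) - M • 1) = 0 := by
      rw [e1, e2, smul_mul_smul_comm, h, smul_zero]
    refine ⟨M • 1 + c • (x - q • 1), ?_, ?_⟩
    · have := exp_of_mul_eq_zero h'
      rw [e1, e2, ep, eq] at this
      have h3 : (L - M) • NormedSpace.exp (M • 1 + c • (x - q • 1)) = (L - M) • x := by
        rw [this]
        have : L - M = c * (p - q) := by rw [hc]; field_simp
        rw [this]
        module
      exact smul_right_injective _ D0 h3
    · intro z hz
      rcases spec_sub h' hz with rfl | rfl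
      · exact log_strip hp'
      · exact log_strip hq'

lemma strip_inj {p q : ℂ} (hp : p.im ∈ Set.Ioo (-Real.pi) Real.pi)
    (hq : q.im ∈ Set.Ioo (-Real.pi) Real.pi) (h : Complex.exp p = Complex.exp q) : p = q := by
  rw [← Complex.log_exp hp.1 hp.2.le, ← Complex.log_exp hq.1 hq.2.le, h]

lemma exp_spec {a : Matrix (Fin 2) (Fin 2) ℂ} {p : ℂ} (hp : p ∈ spectrum ℂ a) :
    Complex.exp p ∈ spectrum ℂ (NormedSpace.exp a) := by
  rw [Complex.exp_eq_exp_ℂ]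
  open scoped Matrix.Norms.Operator in
  exact spectrum.exp_mem_exp a hp

lemma exp_poly {a : Matrix (Fin 2) (Fin 2) ℂ} {p q : ℂ}
    (h : (a - p • 1) * (a - q • 1) = 0) :
    (NormedSpace.exp a - Complex.exp p • 1) * (NormedSpace.exp a - Complex.exp q • 1) = 0 := by
  by_cases hpq : p = q
  · subst hpq
    have : NormedSpace.exp a - Complex.exp p • 1 = Complex.exp p • (a - p • 1) := by
      rw [exp_of_sq_eq_zero h]; module
    rw [this, smul_mul_smul_comm, h, smul_zero]
  · have d0 : p - q ≠ 0 := sub_ne_zero.2 hpq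
    have h3 := exp_of_mul_eq_zero h
    have e1 : (p - q) • (NormedSpace.exp a - Complex.exp p • 1)
        = (Complex.exp p - Complex.exp q) • (a - p • 1) := by
      rw [smul_sub, h3]; module
    have e2 : (p - q) • (NormedSpace.exp a - Complex.exp q • 1)
        = (Complex.exp p - Complex.exp q) • (a - q • 1) := by
      rw [smul_sub, h3]; module
    have : ((p - q) * (p - q)) •
        ((NormedSpace.exp a - Complex.exp p • 1) * (NormedSpace.exp a - Complex.exp q • 1))
        = 0 := by
      rw [← smul_mul_smul_comm, e1, e2, smul_mul_smul_comm, h, smul_zero]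
    exact (smul_eq_zero.1 this).resolve_left (mul_ne_zero d0 d0)

lemma unique_ne {x a b : Matrix (Fin 2) (Fin 2) ℂ} (ha : IsPrincipalLog x a)
    (hb : IsPrincipalLog x b) {p q : ℂ} (hp : p ∈ spectrum ℂ a) (hq : q ∈ spectrum ℂ a)
    (h : (a - p • 1) * (a - q • 1) = 0) (hpq : p ≠ q) : a = b := by
  have hpq' : Complex.exp p ≠ Complex.exp q :=
    fun e => hpq (strip_inj (ha.2 p hp) (ha.2 q hq) e)
  obtain ⟨r, hr, s, hs, h'⟩ := spec_pair b
  have hx := exp_poly h'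
  rw [hb.1] at hx
  have hp1 := exp_spec hp
  have hq1 := exp_spec hq
  rw [ha.1] at hp1 hq1
  have e1 := exp_of_mul_eq_zero h
  have e2 : (p - q) • NormedSpace.exp b =
      Complex.exp p • (b - q • 1) - Complex.exp q • (b - p • 1) := by
    rcases spec_sub hx hp1 with e | e <;> rcases spec_sub hx hq1 with f | f
    · exact absurd (e.trans f.symm) hpq'
    · obtain rfl := strip_inj (ha.2 p hp) (hb.2 _ hr) e
      obtain rfl := strip_inj (ha.2 q hq) (hb.2 _ hs) f
      exact exp_of_mul_eq_zero h'
    · obtain rfl := strip_inj (ha.2 p hp) (hb.2 _ hs) e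
      obtain rfl := strip_inj (ha.2 q hq) (hb.2 _ hr) f
      have := exp_of_mul_eq_zero h'
      rw [← neg_sub, neg_smul, this]
      abel
    · exact absurd (e.trans f.symm) hpq'
  rw [ha.1] at e1
  rw [hb.1, e1] at e2
  have : (Complex.exp p - Complex.exp q) • (a - b) = 0 := by
    rw [← sub_eq_zero] at e2
    rw [← e2]
    module
  exact sub_eq_zero.1 ((smul_eq_zero.1 this).resolve_left (sub_ne_zero.2 hpq'))

/-- A 2×2 matrix has at most one principal logarithm. -/
theorem isPrincipalLog_unique {x a b : Matrix (Fin 2) (Fin 2) ℂ} (ha : IsPrincipalLog x a)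
    (hb : IsPrincipalLog x b) : a = b := by
  obtain ⟨p, hp, q, hq, h⟩ := spec_pair a
  obtain ⟨r, hr, s, hs, h'⟩ := spec_pair b
  by_cases hpq : p = q
  · by_cases hrs : r = s
    · subst hpq hrs
      have hx := exp_poly h'
      rw [hb.1] at hx
      have hp1 := exp_spec hp
      rw [ha.1] at hp1
      have e : Complex.exp p = Complex.exp r := (spec_sub hx hp1).elim id id
      obtain rfl := strip_inj (ha.2 p hp) (hb.2 _ hr) e
      have e1 := exp_of_sq_eq_zero h
      rw [ha.1, ← hb.1, exp_of_sq_eq_zero h'] at e1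
      have := smul_right_injective _ (Complex.exp_ne_zero p) e1
      simpa using this.symm
    · exact (unique_ne hb ha hr hs h' hrs).symm
  · exact unique_ne ha hb hp hq h hpq

/-- `matrixLog x` is the principal logarithm of a 2×2 matrix `x` without eigenvalues
in `]-∞, 0]`. -/
theorem matrixLog_spec {x : Matrix (Fin 2) (Fin 2) ℂ} (hx : NoNonposEigenvalue x) :
    IsPrincipalLog x (matrixLog x) := by
  have h := exists_isPrincipalLog hx
  rw [matrixLog, dif_pos h]
  exact h.choose_spec

end MatrixLog

/-! ### Injectivity of `w + log w` -/

namespace MatrixLog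

open Complex

/-! Put `a = log x`, `b = log y`. For 2×2 matrices each of `exp a`, `exp b`, `exp (a + b)` is affine
in its argument (`exp_eq_affine`). After scalar shifts `a = A + m`, `b = B + l`, the identity `exp a
* exp b = exp (a + b)` says only that `A * B` is scalar. A nonzero scalar makes `A` and `B` commute.
If `A * B = 0` without commuting, the eigenvalues are `0, τ` for `A`, `0, σ` for `B` and `σ, τ` for
`A + B`, where `τ`, `σ` are the traces. Interpolation then puts `0, σ, τ` on one secant `exp z = 1 +
c * z`, with multiplicity, and the strip condition keeps their imaginary parts less than `2π` apart.

Such a secant forces `σ = τ = 0` (`eq_zero_of_secant`), whence `B * A = 0 = A * B`, a contradiction.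
The substitution `w = -(z + c⁻¹)` turns the secant equation into `w * exp w = const`, so distinct
points are excluded by `not_three_mul_exp_eq`: the values `w + log w` differ by multiples of `2πi`,
only neighbouring branches are within reach, and each branch carries one solution, apart from
negative reals. -/

lemma continuousWithinAt_log_upper {z : ℂ} (hz : z ≠ 0) :
    ContinuousWithinAt Complex.log {z : ℂ | 0 ≤ z.im} z := by
  by_cases h : z ∈ slitPlane
  · exact (continuousAt_clog h).continuousWithinAt
  · rw [mem_slitPlane_iff] at h
    push Not at h
    refine continuousWithinAt_log_of_re_neg_of_im_zero (lt_of_le_of_ne h.1 fun hre => hz ?_) h.2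
    exact Complex.ext hre h.2

/-- `w ↦ w + log w` is injective on the closed upper half-plane, up to pairs of real points. -/
lemma add_log_inj_upper {w v : ℂ} (hw0 : w ≠ 0) (hv0 : v ≠ 0) (hw : 0 ≤ w.im) (hv : 0 ≤ v.im)
    (hpos : 0 < w.im + v.im) (h : w + log w = v + log v) : w = v := by
  by_contra hne
  have hd : v - w ≠ 0 := sub_ne_zero.2 (Ne.symm hne)
  set d := v - w with hdef
  have him : ∀ t : ℝ, (w + t * d).im = (1 - t) * w.im + t * v.im := by
    intro t; simp [hdef]; ring
  have himpos : ∀ t ∈ Set.Ioo (0 : ℝ) 1, 0 < (w + t * d).im := by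
    intro t ht
    rw [him]
    rcases hw.lt_or_eq with h1 | h1
    · have := mul_pos (sub_pos.2 ht.2) h1
      have := mul_nonneg ht.1.le hv
      linarith
    · have h2 : 0 < v.im := by linarith
      have := mul_pos ht.1 h2
      rw [← h1]; linarith
  -- Rolle along the segment from `w` to `v`: after division by `d` the derivative is `Im (1 +
  -- 1/z)`, which is negative in the open upper half-plane. An endpoint may lie on the cut, so
  -- continuity there is one-sided.
  have hcont : ContinuousOn (fun t : ℝ => ((w + t * d + log (w + t * d)) / d).im)
      (Set.Icc 0 1) := by
    intro t ht
    have hlin : ContinuousWithinAt (fun t : ℝ => w + t * d) (Set.Icc 0 1) t := by fun_prop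
    have hne0 : w + t * d ≠ 0 := by
      intro h0
      rcases ht.1.lt_or_eq with h1 | h1
      · rcases ht.2.lt_or_eq with h2 | h2
        · have := himpos t ⟨h1, h2⟩
          rw [h0] at this
          simp at this
        · apply hv0
          rw [← h0, h2, hdef]; simp
      · apply hw0
        rw [← h0, ← h1]; simp
    have hlog : ContinuousWithinAt (fun t : ℝ => log (w + t * d)) (Set.Icc 0 1) t := by
      refine ContinuousWithinAt.comp (f := fun t : ℝ => w + t * d)
        (continuousWithinAt_log_upper hne0) hlin ?_
      intro u hu
      change 0 ≤ (w + u * d).im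
      rw [him]
      exact add_nonneg (mul_nonneg (sub_nonneg.2 hu.2) hw) (mul_nonneg hu.1 hv)
    exact continuous_im.continuousAt.comp_continuousWithinAt ((hlin.add hlog).div_const d)
  obtain ⟨t, ht, hder⟩ := exists_hasDerivAt_eq_zero
    (f' := fun t : ℝ => (1 + (w + t * d)⁻¹).im) one_pos hcont (by simp [hdef, h]) (by
      intro t ht
      have hs : w + t * d ∈ slitPlane :=
        mem_slitPlane_iff.2 (Or.inr (himpos t ht).ne')
      have h1 : HasDerivAt (fun z : ℂ => w + z * d) d (t : ℂ) := by
        simpa using ((hasDerivAt_id (t : ℂ)).mul_const d).const_add w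
      have h2 := ((h1.add (h1.clog hs)).div_const d).comp_ofReal
      have h3 : HasDerivAt (fun t : ℝ => ((w + t * d + log (w + t * d)) / d).im)
          ((d + d / (w + t * d)) / d).im t := imCLM.hasFDerivAt.comp_hasDerivAt t h2
      have h4 : (d + d / (w + t * d)) / d = 1 + (w + t * d)⁻¹ := by
        have := slitPlane_ne_zero hs
        field_simp
      rwa [h4] at h3)
  have hp := himpos t ht
  simp only [add_im, one_im, zero_add, inv_im] at hder
  have hns : 0 < normSq (w + t * d) := normSq_pos.2 fun h0 => by rw [h0] at hp; simp at hp
  have : (w + t * d).im / normSq (w + t * d) = 0 := by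
    simp only [add_im] at hder ⊢
    rw [neg_div] at hder
    linarith
  exact (div_pos hp hns).ne' this

lemma arg_pos_of_im_pos {w : ℂ} (h : 0 < w.im) : 0 < arg w :=
  (arg_nonneg_iff.2 h.le).lt_of_ne' fun h0 => h.ne' (arg_eq_zero_iff.1 h0).2

/-- `w ↦ w + log w` is injective, up to pairs of negative real numbers. -/
lemma add_log_inj {w v : ℂ} (hw0 : w ≠ 0) (hv0 : v ≠ 0) (h : w + log w = v + log v) :
    w = v ∨ (w.im = 0 ∧ w.re < 0 ∧ v.im = 0 ∧ v.re < 0) := by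
  -- `Im` and `arg` agree in sign, so `w` and `v` lie on the same side of the real axis; the lower
  -- side follows by conjugation.
  have him : w.im + arg w = v.im + arg v := by
    simpa [log_im] using congrArg Complex.im h
  rcases lt_or_ge w.im 0 with hw | hw
  · have aw := arg_neg_iff.2 hw
    rcases lt_or_ge v.im 0 with hv | hv
    · left
      have e : ∀ {u : ℂ}, u.im < 0 → log ((starRingEnd ℂ) u) = (starRingEnd ℂ) (log u) := by
        intro u hu
        refine log_conj u fun hpi => ?_
        rw [arg_eq_pi_iff] at hpi
        exact hu.ne hpi.2
      refine (starRingEnd ℂ).injective (add_log_inj_upper (by simpa) (by simpa) ?_ ?_ ?_ ?_)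
      · simpa using hw.le
      · simpa using hv.le
      · simp only [conj_im]; linarith
      · rw [e hw, e hv, ← map_add, ← map_add, h]
    · have := arg_nonneg_iff.2 hv
      linarith
  · have aw := arg_nonneg_iff.2 hw
    rcases lt_or_ge v.im 0 with hv | hv
    · have := arg_neg_iff.2 hv
      linarith
    · rcases (add_nonneg hw hv).lt_or_eq with hp | hp
      · exact Or.inl (add_log_inj_upper hw0 hv0 hw hv hp h)
      have w0 : w.im = 0 := by linarith
      have v0 : v.im = 0 := by linarith
      have ew : w = (w.re : ℂ) := Complex.ext rfl (by simp [w0])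
      have ev : v = (v.re : ℂ) := Complex.ext rfl (by simp [v0])
      have rw0 : w.re ≠ 0 := fun h0 => hw0 (by rw [ew, h0]; simp)
      have rv0 : v.re ≠ 0 := fun h0 => hv0 (by rw [ev, h0]; simp)
      rw [w0, v0, zero_add, zero_add] at him
      rcases rw0.lt_or_gt with h1 | h1
      · right
        refine ⟨w0, h1, v0, ?_⟩
        rw [arg_eq_pi_iff.2 ⟨h1, w0⟩] at him
        exact (arg_eq_pi_iff.1 him.symm).1
      · left
        have hv1 : 0 < v.re := by
          rw [arg_eq_zero_iff.2 ⟨h1.le, w0⟩] at him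
          exact (arg_eq_zero_iff.1 him.symm).1.lt_of_ne' rv0
        rw [ew, ev, ← ofReal_log h1.le, ← ofReal_log hv1.le] at h
        norm_cast at h
        rw [ew, ev]
        congr 1
        rcases lt_trichotomy w.re v.re with hl | hl | hl
        · have := Real.log_lt_log h1 hl
          linarith
        · exact hl
        · have := Real.log_lt_log hv1 hl
          linarith

/-! ### Solutions of `w * exp w = c` with close imaginary parts -/

lemma exp_add_log {w : ℂ} (hw : w ≠ 0) : exp (w + log w) = w * exp w := by
  rw [exp_add, exp_log hw, mul_comm]

lemma exists_int_of_mul_exp_eq {w v : ℂ} (hw : w ≠ 0) (hv : v ≠ 0)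
    (h : w * exp w = v * exp v) :
    ∃ k : ℤ, w + log w = v + log v + k * (2 * Real.pi * I) := by
  rw [← exp_add_log hw, ← exp_add_log hv] at h
  exact exp_eq_exp_iff_exists_int.1 h

lemma im_add_arg_eq {w v : ℂ} {k : ℤ} (h : w + log w = v + log v + k * (2 * Real.pi * I)) :
    w.im + arg w = v.im + arg v + k * (2 * Real.pi) := by
  simpa [log_im] using congrArg Complex.im h

/-- Near the real axis, `w * exp w` takes the value `r * exp r` of a negative real `r` only at
negative reals. -/
lemma real_neg_of_mul_exp_eq_upper {r : ℝ} (hr : r < 0) {w : ℂ} (hw0 : 0 ≤ w.im)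
    (hw : w.im < 2 * Real.pi) (h : w * exp w = r * exp r) : w.im = 0 ∧ w.re < 0 := by
  have r0 : (r : ℂ) ≠ 0 := by exact_mod_cast hr.ne
  have w0 : w ≠ 0 := by
    rintro rfl
    rw [zero_mul] at h
    exact mul_ne_zero r0 (exp_ne_zero _) h.symm
  obtain ⟨k, hk⟩ := exists_int_of_mul_exp_eq w0 r0 h
  have him := im_add_arg_eq hk
  rw [arg_ofReal_of_neg hr, ofReal_im] at him
  have a0 := arg_nonneg_iff.2 hw0
  have a1 := arg_le_pi w
  have pi0 := Real.pi_pos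
  -- The left side of `him` lies in `[0, 3π)` and the right side is `π + 2πk`.
  have k0 : k = 0 := by
    have h1 : -1 < k := by
      by_contra hk1
      have : (k : ℝ) ≤ -1 := by exact_mod_cast not_lt.1 hk1
      nlinarith
    have h2 : k < 1 := by
      by_contra hk1
      have : (1 : ℝ) ≤ k := by exact_mod_cast not_lt.1 hk1
      nlinarith
    omega
  rw [k0] at hk
  rcases add_log_inj w0 r0 (by simpa using hk) with e | e
  · rw [e]; exact ⟨ofReal_im r, by simpa using hr⟩
  · exact ⟨e.1, e.2.1⟩

lemma real_neg_of_mul_exp_eq {r : ℝ} (hr : r < 0) {w : ℂ}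
    (hw : |w.im| < 2 * Real.pi) (h : w * exp w = r * exp r) : w.im = 0 ∧ w.re < 0 := by
  rw [abs_lt] at hw
  rcases le_total 0 w.im with h0 | h0
  · exact real_neg_of_mul_exp_eq_upper hr h0 hw.2 h
  · have := real_neg_of_mul_exp_eq_upper hr (w := (starRingEnd ℂ) w) (by simpa using h0)
      (by rw [conj_im]; linarith) (by
        have := congrArg (starRingEnd ℂ) h
        simpa [← exp_conj] using this)
    simpa using this

/-- `x * exp x` takes no value at three distinct negative reals. -/
lemma not_three_real_neg {x y z : ℝ} (hx : x < 0) (hy : y < 0) (hz : z < 0) (hxy : x < y)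
    (hyz : y < z) (h1 : x * Real.exp x = y * Real.exp y) (h2 : y * Real.exp y = z * Real.exp z) :
    False := by
  have e : ∀ {u : ℝ}, u < 0 → Real.log (-(u * Real.exp u)) = Real.log (-u) + u := by
    intro u hu
    rw [← neg_mul, Real.log_mul (by linarith) (Real.exp_ne_zero _), Real.log_exp]
  have e1 := e hx
  have e2 := e hy
  have e3 := e hz
  rw [h1] at e1
  rw [← h2] at e3
  -- The points `(-u, log (-u))` for `u = x, y, z` lie on a line of slope 1, against strict
  -- concavity of `log`.
  have s := strictConcaveOn_log_Ioi.slope_anti_adjacent (x := -z) (y := -y) (z := -x)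
    (by simpa using hz) (by simpa using hx) (by linarith) (by linarith)
  rw [div_lt_div_iff₀ (by linarith) (by linarith)] at s
  have l1 : Real.log (-x) = Real.log (-y) + y - x := by linarith
  have l2 : Real.log (-z) = Real.log (-y) + y - z := by linarith
  rw [l1, l2] at s
  nlinarith

lemma not_three_real_neg_of_ne {x y z : ℝ} (hx : x < 0) (hy : y < 0) (hz : z < 0) (hxy : x ≠ y)
    (hyz : y ≠ z) (hxz : x ≠ z) (h1 : x * Real.exp x = y * Real.exp y)
    (h2 : y * Real.exp y = z * Real.exp z) : False := by
  rcases hxy.lt_or_gt with a | a <;> rcases hyz.lt_or_gt with b | b <;>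
    rcases hxz.lt_or_gt with c | c
  · exact not_three_real_neg hx hy hz a b h1 h2
  · exact not_three_real_neg hx hy hz a b h1 h2
  · exact not_three_real_neg hx hz hy c b (h1.trans h2) h2.symm
  · exact not_three_real_neg hz hx hy c a (h1.trans h2).symm h1
  · exact not_three_real_neg hy hx hz a c h1.symm (h1.trans h2)
  · exact not_three_real_neg hy hz hx b c h2 (h1.trans h2).symm
  · exact not_three_real_neg hz hy hx b a h2.symm h1.symm
  · exact not_three_real_neg hz hy hx b a h2.symm h1.symm

/-- Handles the exception in `add_log_inj`: since `u` is real, the bound on `u - w` bounds `w.im`,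
so `w` is a negative real too. -/
lemma not_three_of_real_neg {u v w : ℂ} (huv : u ≠ v) (hvw : v ≠ w) (huw : u ≠ w)
    (hu : u.im = 0) (hu' : u.re < 0) (hv : v.im = 0) (hv' : v.re < 0)
    (h1 : u * exp u = v * exp v) (h2 : v * exp v = w * exp w)
    (hw : |(u - w).im| < 2 * Real.pi) : False := by
  have key : ∀ {z : ℂ}, z.im = 0 → ((z.re : ℝ) : ℂ) = z := fun hz =>
    Complex.ext (by simp) (by simp [hz])
  have hw1 : |w.im| < 2 * Real.pi := by simpa [hu] using hw
  obtain ⟨w0, w1⟩ := real_neg_of_mul_exp_eq hu' hw1 (by rw [key hu, h1, h2])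
  rw [← key hu, ← key hv] at h1 huv
  rw [← key hv, ← key w0] at h2 hvw
  rw [← key hu, ← key w0] at huw
  norm_cast at h1 h2 huv hvw huw
  exact not_three_real_neg_of_ne hu' hv' w1 huv hvw huw h1 h2

/-- Solutions of `w * exp w = c` with imaginary parts at distance less than `2 * π` lie on the same
or on neighbouring branches. -/
lemma branch_bound {w v : ℂ} {k : ℤ} (h : w + log w = v + log v + k * (2 * Real.pi * I))
    (him : |(w - v).im| < 2 * Real.pi) : |k| ≤ 1 := by
  have e := im_add_arg_eq h
  rw [sub_im, abs_lt] at him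
  have := arg_le_pi w
  have := arg_le_pi v
  have := neg_pi_lt_arg w
  have := neg_pi_lt_arg v
  have pi0 := Real.pi_pos
  rw [abs_le]
  constructor
  · by_contra hk
    have : (k : ℝ) ≤ -2 := by
      have : k ≤ -2 := by omega
      exact_mod_cast this
    nlinarith
  · by_contra hk
    have : (2 : ℝ) ≤ k := by
      have : 2 ≤ k := by omega
      exact_mod_cast this
    nlinarith

/-- The equation `w * exp w = c` does not have three distinct solutions whose imaginary parts are
pairwise at distance less than `2 * π`. -/
lemma not_three_mul_exp_eq {u v w : ℂ} (hu0 : u ≠ 0) (hv0 : v ≠ 0) (hw0 : w ≠ 0)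
    (huv : u ≠ v) (hvw : v ≠ w) (huw : u ≠ w)
    (h1 : u * exp u = v * exp v) (h2 : v * exp v = w * exp w)
    (b1 : |(u - v).im| < 2 * Real.pi) (b2 : |(v - w).im| < 2 * Real.pi)
    (b3 : |(u - w).im| < 2 * Real.pi) : False := by
  obtain ⟨k, hk⟩ := exists_int_of_mul_exp_eq hu0 hv0 h1
  obtain ⟨l, hl⟩ := exists_int_of_mul_exp_eq hv0 hw0 h2
  have hkl : u + log u = w + log w + (k + l : ℤ) * (2 * Real.pi * I) := by
    rw [hk, hl]; push_cast; ring
  have k1 := branch_bound hk b1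
  have l1 := branch_bound hl b2
  have kl1 := branch_bound hkl b3
  have k0 : k ≠ 0 := by
    rintro rfl
    rcases add_log_inj hu0 hv0 (by simpa using hk) with e | ⟨a, b, c, d⟩
    · exact huv e
    · exact not_three_of_real_neg huv hvw huw a b c d h1 h2 b3
  have l0 : l ≠ 0 := by
    rintro rfl
    rcases add_log_inj hv0 hw0 (by simpa using hl) with e | ⟨a, b, c, d⟩
    · exact hvw e
    · refine not_three_of_real_neg hvw huw.symm huv.symm a b c d h2 (h1.trans h2).symm ?_
      rwa [← abs_neg, ← neg_im, neg_sub]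
  have kl0 : k + l ≠ 0 := by
    intro h0
    rw [h0] at hkl
    rcases add_log_inj hu0 hw0 (by simpa using hkl) with e | ⟨a, b, c, d⟩
    · exact huw e
    · exact not_three_of_real_neg huw hvw.symm huv a b c d (h1.trans h2) h2.symm b1
  -- `k`, `l` and `k + l` would all be `±1`, which parity forbids.
  rw [abs_le] at k1 l1 kl1
  omega

/-! ### Secants and tangents of the exponential -/

/-- The tangent case at `0`. With `w = -1 - t` the equation reads `w * exp w = -exp (-1)`, so `t` is
real, and there `1 + t < exp t` unless `t = 0`. -/
lemma eq_zero_of_exp_eq_add_one {t : ℂ} (h : exp t = 1 + t) (ht : |t.im| < 2 * Real.pi) :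
    t = 0 := by
  have h1 : (-1 - t) * exp (-1 - t) = ((-1 : ℝ) : ℂ) * exp ((-1 : ℝ) : ℂ) := by
    rw [sub_eq_add_neg (-1) t, exp_add, exp_neg t, h]
    have : 1 + t ≠ 0 := h ▸ exp_ne_zero t
    push_cast
    field_simp
    ring
  obtain ⟨h2, -⟩ := real_neg_of_mul_exp_eq (by norm_num) (by simpa using ht) h1
  have h3 : t.im = 0 := by simpa using h2
  have h4 : ((t.re : ℝ) : ℂ) = t := Complex.ext (by simp) (by simp [h3])
  rw [← h4] at h ⊢
  norm_cast at h ⊢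
  by_contra hne
  have := Real.add_one_lt_exp hne
  linarith

/-- A secant line of the exponential through `0` meets it in no further pair of points with
pairwise small imaginary differences, also when points are counted with multiplicity. -/
lemma eq_zero_of_secant {A s t : ℂ} (hA : A ≠ 0) (hs : A * s = exp s - 1)
    (ht : A * t = exp t - 1) (hs0 : s = 0 → A = 1) (ht0 : t = 0 → A = 1) (hst : s = t → A = exp s)
    (bs : |s.im| < 2 * Real.pi) (bt : |t.im| < 2 * Real.pi) (bst : |(s - t).im| < 2 * Real.pi) :
    s = 0 ∧ t = 0 := by
  by_cases s0 : s = 0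
  · refine ⟨s0, eq_zero_of_exp_eq_add_one ?_ bt⟩
    rw [hs0 s0] at ht
    linear_combination -ht
  by_cases t0 : t = 0
  · refine ⟨eq_zero_of_exp_eq_add_one ?_ bs, t0⟩
    rw [ht0 t0] at hs
    linear_combination -hs
  by_cases e : s = t
  · subst e
    exfalso
    rw [hst rfl] at hs
    -- The line is tangent at `s` and passes through `(0, 1)`; dividing by `exp s` gives the tangent
    -- equation at `0` for `-s`.
    refine s0 (neg_eq_zero.1 (eq_zero_of_exp_eq_add_one ?_ (by simpa using bs)))
    rw [exp_neg]
    field_simp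
    linear_combination hs
  exfalso
  have key : ∀ {z : ℂ}, A * z = exp z - 1 → -(z + A⁻¹) = -(exp z * A⁻¹) := by
    intro z hz
    have : exp z = A * z + 1 := by linear_combination -hz
    rw [this]
    field_simp
  have ne : ∀ {z : ℂ}, A * z = exp z - 1 → -(z + A⁻¹) ≠ 0 := by
    intro z hz
    rw [key hz]
    exact neg_ne_zero.2 (mul_ne_zero (exp_ne_zero _) (inv_ne_zero hA))
  have val : ∀ {z : ℂ}, A * z = exp z - 1 →
      -(z + A⁻¹) * exp (-(z + A⁻¹)) = -(A⁻¹ * exp (-A⁻¹)) := by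
    intro z hz
    nth_rewrite 1 [key hz]
    rw [neg_add, exp_add, exp_neg z]
    have := exp_ne_zero z
    field_simp
  have hz : A * 0 = exp 0 - 1 := by simp
  refine not_three_mul_exp_eq (ne hz) (ne hs) (ne ht) ?_ ?_ ?_
    ((val hz).trans (val hs).symm) ((val hs).trans (val ht).symm) ?_ ?_ ?_
  · simpa using s0
  · simpa using e
  · simpa using t0
  · have : -(0 + A⁻¹) - -(s + A⁻¹) = s := by ring
    rwa [this]
  · have : -(s + A⁻¹) - -(t + A⁻¹) = -(s - t) := by ring
    rwa [this, neg_im, abs_neg]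
  · have : -(0 + A⁻¹) - -(t + A⁻¹) = t := by ring
    rwa [this]

end MatrixLog

/-! ### From 2×2 matrices to a secant of the exponential -/

namespace MatrixLog

lemma mem_spectrum_iff_det {a : Matrix (Fin 2) (Fin 2) ℂ} {z : ℂ} :
    z ∈ spectrum ℂ a ↔ (a - z • 1).det = 0 := by
  rw [spectrum.mem_iff, Matrix.isUnit_iff_isUnit_det, isUnit_iff_ne_zero, not_not,
    Algebra.algebraMap_eq_smul_one, ← neg_sub, Matrix.det_neg]
  simp

/-- A matrix with small spectrum has its exponential affine in it, with nonzero slope; the affine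
function interpolates the exponential on the spectrum. -/
lemma exp_eq_affine {a : Matrix (Fin 2) (Fin 2) ℂ}
    (ha : ∀ z ∈ spectrum ℂ a, z.im ∈ Set.Ioo (-Real.pi) Real.pi) :
    ∃ P Q : ℂ, NormedSpace.exp a = P • 1 + Q • a ∧ Q ≠ 0 ∧
      (∀ z ∈ spectrum ℂ a, Complex.exp z = P + Q * z) ∧
      ∀ z, (a - z • 1) * (a - z • 1) = 0 → Q = Complex.exp z := by
  obtain ⟨p, hp, q, hq, h⟩ := spec_pair a
  by_cases hpq : p = q
  · subst hpq
    refine ⟨Complex.exp p * (1 - p), Complex.exp p, ?_, Complex.exp_ne_zero p, ?_, ?_⟩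
    · rw [exp_of_sq_eq_zero h]; module
    · intro z hz
      obtain rfl : z = p := (spec_sub h hz).elim id id
      ring
    · intro z hz
      rw [(spec_sub hz hp).elim id id]
  · have d0 : p - q ≠ 0 := sub_ne_zero.2 hpq
    have e0 : Complex.exp p - Complex.exp q ≠ 0 :=
      sub_ne_zero.2 fun e => hpq (strip_inj (ha p hp) (ha q hq) e)
    refine ⟨(p * Complex.exp q - q * Complex.exp p) / (p - q),
      (Complex.exp p - Complex.exp q) / (p - q), ?_, div_ne_zero e0 d0, ?_, ?_⟩
    · refine smul_right_injective _ d0 ?_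
      simp only
      rw [exp_of_mul_eq_zero h, smul_add, smul_smul, smul_smul, mul_div_cancel₀ _ d0,
        mul_div_cancel₀ _ d0]
      module
    · intro z hz
      rcases spec_sub h hz with rfl | rfl <;> field_simp <;> ring
    · intro z hz
      have e1 := (spec_sub hz hp).elim id id
      have e2 := (spec_sub hz hq).elim id id
      exact absurd (e1.trans e2.symm) hpq

/-- Cayley–Hamilton with vanishing determinant. -/
lemma mul_sub_trace {A : Matrix (Fin 2) (Fin 2) ℂ} (h : A.det = 0) :
    A * (A - A.trace • 1) = 0 := by
  rw [Matrix.det_fin_two] at h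
  ext i j
  fin_cases i <;> fin_cases j <;>
    simp [Matrix.mul_apply, Fin.sum_univ_two, Matrix.trace_fin_two] <;>
    first | ring1 | linear_combination -h

lemma det_sub_trace (A : Matrix (Fin 2) (Fin 2) ℂ) : (A - A.trace • 1).det = A.det := by
  simp [Matrix.det_fin_two, Matrix.trace_fin_two]
  ring

/-- `M - tr M` is minus the adjugate of `M`, and the adjugate reverses products. -/
lemma sub_trace_mul_sub_trace {A B : Matrix (Fin 2) (Fin 2) ℂ} (h : A * B = 0) :
    (B - B.trace • 1) * (A - A.trace • 1) = 0 := by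
  have e : ∀ M : Matrix (Fin 2) (Fin 2) ℂ, M - M.trace • 1 = -M.adjugate := by
    intro M
    rw [Matrix.adjugate_fin_two]
    ext i j
    fin_cases i <;> fin_cases j <;> simp [Matrix.trace_fin_two]
  rw [e, e, neg_mul_neg, ← Matrix.adjugate_mul_distrib, h, Matrix.adjugate_zero]

/-- If one factor were invertible, the other would be zero and commute with it. -/
lemma det_eq_zero_of_mul_eq_zero {A B : Matrix (Fin 2) (Fin 2) ℂ} (h : A * B = 0)
    (hc : ¬ Commute A B) : A.det = 0 ∧ B.det = 0 := by
  constructor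
  · by_contra hd
    have hu : IsUnit A := (Matrix.isUnit_iff_isUnit_det A).2 (isUnit_iff_ne_zero.2 hd)
    rw [hu.mul_right_eq_zero] at h
    exact hc (h ▸ Commute.zero_right A)
  · by_contra hd
    have hu : IsUnit B := (Matrix.isUnit_iff_isUnit_det B).2 (isUnit_iff_ne_zero.2 hd)
    rw [hu.mul_left_eq_zero] at h
    exact hc (h ▸ Commute.zero_left B)

lemma commute_of_mul_eq_smul_one {A B : Matrix (Fin 2) (Fin 2) ℂ} {c : ℂ} (hc : c ≠ 0)
    (h : A * B = c • 1) : Commute A B := by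
  have h1 : (c⁻¹ • A) * B = 1 := by
    rw [smul_mul_assoc, h, smul_smul, inv_mul_cancel₀ hc, one_smul]
  have h2 := mul_eq_one_comm.1 h1
  rw [mul_smul_comm] at h2
  have h3 : B * A = c • 1 := by rw [← h2, smul_smul, mul_inv_cancel₀ hc, one_smul]
  exact h.trans h3.symm

lemma abs_im_sub_lt {p q : ℂ} (hp : p.im ∈ Set.Ioo (-Real.pi) Real.pi)
    (hq : q.im ∈ Set.Ioo (-Real.pi) Real.pi) : |(p - q).im| < 2 * Real.pi := by
  rw [Complex.sub_im, abs_lt]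
  constructor <;> linarith [hp.1, hp.2, hq.1, hq.2]

/-- If `exp a * exp b = exp (a + b)` for 2×2 matrices whose eigenvalues, and those of `a + b`, have
imaginary part in `]-π, π[`, then `a` and `b` commute. -/
theorem commute_of_exp_mul_exp {a b : Matrix (Fin 2) (Fin 2) ℂ}
    (ha : ∀ z ∈ spectrum ℂ a, z.im ∈ Set.Ioo (-Real.pi) Real.pi)
    (hb : ∀ z ∈ spectrum ℂ b, z.im ∈ Set.Ioo (-Real.pi) Real.pi)
    (hab : ∀ z ∈ spectrum ℂ (a + b), z.im ∈ Set.Ioo (-Real.pi) Real.pi)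
    (h : NormedSpace.exp a * NormedSpace.exp b = NormedSpace.exp (a + b)) : Commute a b := by
  obtain ⟨P₁, Q₁, e₁, Q₁0, i₁, j₁⟩ := exp_eq_affine ha
  obtain ⟨P₂, Q₂, e₂, Q₂0, i₂, j₂⟩ := exp_eq_affine hb
  obtain ⟨P₃, Q₃, e₃, Q₃0, i₃, j₃⟩ := exp_eq_affine hab
  rw [e₁, e₂, e₃] at h
  -- `m` and `l` are chosen so that in the expanded product `A` and `B` both get the coefficient
  -- `Q₃`, cancelling the right-hand side.
  obtain ⟨m, hm⟩ : ∃ m, P₁ + Q₁ * m = Q₃ / Q₂ := ⟨(Q₃ / Q₂ - P₁) / Q₁, by field_simp; ring⟩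
  obtain ⟨l, hl⟩ : ∃ l, P₂ + Q₂ * l = Q₃ / Q₁ := ⟨(Q₃ / Q₁ - P₂) / Q₂, by field_simp; ring⟩
  have hm' : Q₂ * (P₁ + Q₁ * m) = Q₃ := by rw [hm]; field_simp
  have hl' : Q₁ * (P₂ + Q₂ * l) = Q₃ := by rw [hl]; field_simp
  obtain ⟨A, rfl⟩ : ∃ A, a = A + m • 1 := ⟨a - m • 1, by abel⟩
  obtain ⟨B, rfl⟩ : ∃ B, b = B + l • 1 := ⟨b - l • 1, by abel⟩
  suffices hAB : Commute A B from
    (hAB.add_right ((Commute.one_right A).smul_right l)).add_left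
      ((Commute.one_left _).smul_left m)
  by_contra hc
  obtain ⟨κ, hκ⟩ : ∃ κ : ℂ, A * B = κ • 1 := by
    have h1 : (Q₁ * Q₂) • (A * B) =
        (P₃ + Q₃ * (m + l) - (P₁ + Q₁ * m) * (P₂ + Q₂ * l)) • 1 := by
      have h2 : (P₁ • (1 : Matrix (Fin 2) (Fin 2) ℂ) + Q₁ • (A + m • 1)) *
          (P₂ • 1 + Q₂ • (B + l • 1)) = (Q₁ * Q₂) • (A * B) + (Q₁ * (P₂ + Q₂ * l)) • A +
            (Q₂ * (P₁ + Q₁ * m)) • B + ((P₁ + Q₁ * m) * (P₂ + Q₂ * l)) • 1 := by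
        simp only [add_mul, mul_add, smul_mul_assoc, mul_smul_comm, one_mul, mul_one]
        module
      rw [h2, hl', hm'] at h
      rw [← sub_eq_zero] at h ⊢
      rw [← h]
      module
    refine ⟨(Q₁ * Q₂)⁻¹ * (P₃ + Q₃ * (m + l) - (P₁ + Q₁ * m) * (P₂ + Q₂ * l)), ?_⟩
    rw [mul_smul, ← h1, smul_smul, inv_mul_cancel₀ (mul_ne_zero Q₁0 Q₂0), one_smul]
  by_cases hκ0 : κ ≠ 0
  · exact hc (commute_of_mul_eq_smul_one hκ0 hκ)
  rw [not_not.1 hκ0, zero_smul] at hκ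
  obtain ⟨dA, dB⟩ := det_eq_zero_of_mul_eq_zero hκ hc
  have sq := sub_trace_mul_sub_trace hκ
  have mA := mul_sub_trace dA
  have mB := mul_sub_trace dB
  have dA' := det_sub_trace A
  have dB' := det_sub_trace B
  rw [dA] at dA'
  rw [dB] at dB'
  set τ := A.trace
  set σ := B.trace
  have factor : (A + B - σ • 1) * (A + B - τ • 1) = 0 := by
    have : (A + B - σ • 1) * (A + B - τ • 1) = A * (A - τ • 1) + B * (B - σ • 1) +
        A * B + (B - σ • 1) * (A - τ • 1) := by
      simp only [add_mul, mul_add, sub_mul, mul_sub, smul_mul_assoc, mul_smul_comm, one_mul,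
        mul_one]
      module
    rw [this, mA, mB, hκ, sq, add_zero, add_zero, add_zero]
  have dAB : ∀ z : ℂ, z = σ ∨ z = τ → (A + B - z • 1).det = 0 := by
    have hd := congrArg Matrix.det factor
    rw [Matrix.det_mul] at hd
    -- Since `A + B` has trace `σ + τ`, its characteristic polynomial is symmetric under `σ ↔ τ`; so
    -- both determinants vanish, not just one.
    have he : (A + B - σ • 1).det = (A + B - τ • 1).det := by
      have t1 : τ = A 0 0 + A 1 1 := Matrix.trace_fin_two A
      have t2 : σ = B 0 0 + B 1 1 := Matrix.trace_fin_two B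
      rw [t1, t2]
      simp [Matrix.det_fin_two]
      ring
    rw [he, Matrix.det_zero, mul_self_eq_zero] at hd
    rintro z (rfl | rfl)
    · rw [he, hd]
    · exact hd
  have sm : m ∈ spectrum ℂ (A + m • 1) := by rw [mem_spectrum_iff_det]; simpa using dA
  have smτ : m + τ ∈ spectrum ℂ (A + m • 1) := by
    rw [mem_spectrum_iff_det, ← dA']; congr 1; module
  have sl : l ∈ spectrum ℂ (B + l • 1) := by rw [mem_spectrum_iff_det]; simpa using dB
  have slσ : l + σ ∈ spectrum ℂ (B + l • 1) := by
    rw [mem_spectrum_iff_det, ← dB']; congr 1; module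
  have sσ : m + l + σ ∈ spectrum ℂ (A + m • 1 + (B + l • 1)) := by
    rw [mem_spectrum_iff_det, ← dAB σ (Or.inl rfl)]; congr 1; module
  have sτ : m + l + τ ∈ spectrum ℂ (A + m • 1 + (B + l • 1)) := by
    rw [mem_spectrum_iff_det, ← dAB τ (Or.inr rfl)]; congr 1; module
  have em := i₁ m sm
  have emτ := i₁ _ smτ
  have el := i₂ l sl
  have elσ := i₂ _ slσ
  rw [← em] at hm'
  rw [← el] at hl'
  rw [Complex.exp_add] at emτ elσ
  have m0 := Complex.exp_ne_zero m
  have l0 := Complex.exp_ne_zero l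
  have Q₁e : Q₁ = Q₃ / Complex.exp l := by rw [← hl']; field_simp
  have Q₂e : Q₂ = Q₃ / Complex.exp m := by rw [← hm']; field_simp
  obtain ⟨hσ, hτ⟩ := eq_zero_of_secant (A := Q₃ / (Complex.exp m * Complex.exp l))
    (s := σ) (t := τ) (div_ne_zero Q₃0 (mul_ne_zero m0 l0))
    (by
      have : Q₂ * σ = Complex.exp l * (Complex.exp σ - 1) := by linear_combination el - elσ
      rw [Q₂e] at this
      field_simp at this ⊢
      linear_combination this)
    (by
      have : Q₁ * τ = Complex.exp m * (Complex.exp τ - 1) := by linear_combination em - emτ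
      rw [Q₁e] at this
      field_simp at this ⊢
      linear_combination this)
    -- Multiplicities: if `σ = 0`, `τ = 0` or `σ = τ`, then `b`, `a` or `a + b` respectively has a
    -- double eigenvalue, and the affine slope there is the derivative of `exp`.
    (by
      intro h0
      rw [h0, zero_smul, sub_zero] at mB
      have := j₂ l (by simpa using mB)
      rw [div_eq_one_iff_eq (mul_ne_zero m0 l0), ← hm', this, mul_comm])
    (by
      intro h0
      rw [h0, zero_smul, sub_zero] at mA
      have := j₁ m (by simpa using mA)
      rw [div_eq_one_iff_eq (mul_ne_zero m0 l0), ← hl', this])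
    (by
      intro h0
      rw [← h0] at factor
      have e : A + m • 1 + (B + l • 1) - (m + l + σ) • 1 = A + B - σ • 1 := by module
      have := j₃ (m + l + σ) (by rw [e, factor])
      rw [this, Complex.exp_add, Complex.exp_add]
      field_simp)
    (by simpa using abs_im_sub_lt (hb _ slσ) (hb _ sl))
    (by simpa using abs_im_sub_lt (ha _ smτ) (ha _ sm))
    (by
      have := abs_im_sub_lt (hab _ sσ) (hab _ sτ)
      rwa [add_sub_add_left_eq_sub] at this)
  -- With both traces zero, `sq` becomes `B * A = 0`.
  rw [hσ, hτ, zero_smul, sub_zero, sub_zero] at sq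
  exact hc (hκ.trans sq.symm)

end MatrixLog

theorem theorem1 (x y : Matrix (Fin 2) (Fin 2) ℂ)
    (hx : NoNonposEigenvalue x) (hy : NoNonposEigenvalue y) (hxy : NoNonposEigenvalue (x * y))
    (hlog : matrixLog (x * y) = matrixLog x + matrixLog y) :
    Commute x y := by
  have lx := MatrixLog.matrixLog_spec hx
  have ly := MatrixLog.matrixLog_spec hy
  have lxy := MatrixLog.matrixLog_spec hxy
  rw [hlog] at lxy
  have hc : Commute (matrixLog x) (matrixLog y) :=
    MatrixLog.commute_of_exp_mul_exp lx.2 ly.2 lxy.2 (by rw [lx.1, ly.1, lxy.1])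
  rw [← lx.1, ← ly.1]
  open scoped Matrix.Norms.Operator in
  exact hc.exp
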